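/- Let $\mathbb D=\{z\in\mathbb C:|z|<1\}$, let $\operatorname{Hol}(\mathbb D)$ be the space of holomorphic functions on $\mathbb D$ with the topology of uniform convergence on compact sets, and let $\mathcal O(\overline{\mathbb D})$ be the space of functions holomorphic on a neighbourhood of $\overline{\mathbb D}$ with its usual (locally convex inductive limit) topology. Let $\mathcal B$ be a complex Banach space of holomorphic functions on $\mathbb D$ such that ($\star$) $\mathcal O(\overline{\mathbb D})\hookrightarrow\mathcal B\hookrightarrow\operatorname{Hol}(\mathbb D)$, with both embeddings continuous; ($\star\star$) for every univalent (holomorphic and injective) function $\eta:\mathbb D\to\mathbb D$ with $\eta(0)=0$ and every $f\in\mathcal B$, one has $f\circ\eta\in\mathcal B$ and $\|f\circ\eta\|_{\mathcal B}\le\|f\|_{\mathcal B}$. A holomorphic flow is a family $\{\phi_t\}_{t\ge0}$ of holomorphic maps $\phi_t:\mathbb D\to\mathbb D$ such that $\phi_0(z)=z$, $\phi_{t+s}=\phi_t\circ\phi_s$ for all $t,s\ge0$, and $t\mapsto\phi_t(z)$ is continuous on $[0,\infty)$ for each $z\in\mathbb D$. It is said to generate a bounded semigroup of composition operators on $\mathcal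 B$ if, for each $t\ge0$, $T_tf=f\circ\phi_t$ defines a bounded linear operator on $\mathcal B$ (so that $T_0=I$ and $T_{t+s}=T_tT_s$; neither strong continuity nor a bound uniform in $t$ is required). The semigroup is quasicontractive if there is $\omega\in\mathbb R$ with $\|T_t\|\le e^{\omega t}$ for all $t\ge0$. For a holomorphic $\phi:\mathbb D\to\mathbb D$ put $C_\phi f=f\circ\phi$, and for $r\in(0,1)$ put $\alpha_r(z)=\dfrac{z+r}{1+rz}$. Then the following holds. (i) Every holomorphic flow generates a bounded semigroup of composition operators on $\mathcal B$ if and only if the operators $C_{\alpha_r}$ are bounded on $\mathcal B$ for all $r\in(0,1)$. (ii) Every holomorphic flow generates a quasicontractive semigroup of composition operators on $\mathcal B$ if and only if there is a constant $a\ge0$ such that, for all $r\in(0,1)$, $C_{\alpha_r}$ is bounded on $\mathcal B$ and $$\|C_{\alpha_r}\|_{\mathcal L(\mathcal B)}\le\left(\frac{1+r}{1-r}\right)^a .$$ Moreover, for any $a\ge0$ for which this estimate holds for all $r\in(0,1)$, and for every univalent function $\phi:\mathbb D\to\mathbb D$, the operator $C_\phi$ is bounded on $\mathcal B$ and $$\|C_\phi\|_{\mathcal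 L(\mathcal B)}\le\left(\frac{1+|\phi(0)|}{1-|\phi(0)|}\right)^a .$$ -/

import Mathlib

open scoped NNReal

/-- A function on an open set `U ⊆ ℂ` is holomorphic. -/
def IsHolo (U : TopologicalSpace.Opens ℂ) (f : U → ℂ) : Prop :=
  ∃ F : ℂ → ℂ, DifferentiableOn ℂ F (U : Set ℂ) ∧ ∀ z : U, F z = f z

/-- `Hol(U)`: the holomorphic functions on `U`, with the topology of uniform convergence on
compact subsets of `U` (the compact-open topology, inherited from `C(U, ℂ)`). -/
def Hol (U : TopologicalSpace.Opens ℂ) : Submodule ℂ C(U, ℂ) where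
  carrier := {f | IsHolo U f}
  add_mem' := by
    rintro f g ⟨F, hF, hFf⟩ ⟨G, hG, hGg⟩
    exact ⟨F + G, hF.add hG, fun z => by simp [hFf, hGg]⟩
  zero_mem' := ⟨fun _ => 0, differentiableOn_const 0, fun _ => rfl⟩
  smul_mem' := by
    rintro c f ⟨F, hF, hFf⟩
    exact ⟨c • F, hF.const_smul c, fun z => by simp [hFf]⟩

/-- The open unit disc. -/
def unitDisc : TopologicalSpace.Opens ℂ := ⟨Metric.ball 0 1, Metric.isOpen_ball⟩

/-- The centre of the unit disc. -/
def discZero : unitDisc := ⟨0, Metric.mem_ball_self one_pos⟩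

/-- A point of the open disc, as a point of the closed disc. -/
def toClosedDisc (z : unitDisc) : Metric.closedBall (0 : ℂ) 1 :=
  ⟨z, Metric.ball_subset_closedBall z.2⟩

/-- The vector space of functions on the closed unit disc that extend holomorphically to an open
neighbourhood of it. (Such a function determines the germ of its extension along the closed
disc.) -/
def holClosedDiscSubmodule : Submodule ℂ (Metric.closedBall (0 : ℂ) 1 → ℂ) where
  carrier := {f | ∃ (U : TopologicalSpace.Opens ℂ) (_ : Metric.closedBall (0 : ℂ) 1 ⊆ U)
    (F : ℂ → ℂ), DifferentiableOn ℂ F U ∧ ∀ z : Metric.closedBall (0 : ℂ) 1, F z = f z}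
  add_mem' := by
    rintro f g ⟨U, hU, F, hF, hFf⟩ ⟨V, hV, G, hG, hGg⟩
    refine ⟨U ⊓ V, fun z hz => ⟨hU hz, hV hz⟩, F + G, ?_, fun z => by simp [hFf, hGg]⟩
    exact (hF.mono fun z hz => hz.1).add (hG.mono fun z hz => hz.2)
  zero_mem' := ⟨⊤, fun _ _ => trivial, fun _ => 0, differentiableOn_const 0, fun _ => rfl⟩
  smul_mem' := by
    rintro c f ⟨U, hU, F, hF, hFf⟩
    exact ⟨U, hU, c • F, hF.const_smul c, fun z => by simp [hFf]⟩

/-- `𝒪(closed disc)`, as a vector space. A type of its own, so that it does not inherit the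
topology of pointwise convergence. -/
def HolClosedDisc : Type := holClosedDiscSubmodule

instance : AddCommGroup HolClosedDisc := inferInstanceAs (AddCommGroup holClosedDiscSubmodule)

instance : Module ℂ HolClosedDisc := inferInstanceAs (Module ℂ holClosedDiscSubmodule)

/-- The values on the closed disc of an element of `𝒪(closed disc)`. -/
def HolClosedDisc.eval (g : HolClosedDisc) : Metric.closedBall (0 : ℂ) 1 → ℂ := g.1

/-- The restriction map `Hol(U) → 𝒪(closed disc)`, for an open `U` containing the closed disc. -/
noncomputable def restrictToClosedDisc (U : TopologicalSpace.Opens ℂ)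
    (hU : Metric.closedBall (0 : ℂ) 1 ⊆ (U : Set ℂ)) : Hol U →ₗ[ℂ] HolClosedDisc where
  toFun f := ⟨fun z => f.1 ⟨z, hU z.2⟩, by
    obtain ⟨F, hF, hFf⟩ := f.2
    exact ⟨U, hU, F, hF, fun z => hFf ⟨z, hU z.2⟩⟩⟩
  map_add' _ _ := rfl
  map_smul' _ _ := rfl

/-- The usual topology of `𝒪(closed disc)`: the locally convex inductive limit of the spaces
`Hol(U)` over the open neighbourhoods `U` of the closed disc, that is, the finest locally convex
vector space topology for which all the restriction maps are continuous. -/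
instance : TopologicalSpace HolClosedDisc :=
  sInf {τ | @IsTopologicalAddGroup HolClosedDisc τ _ ∧ @ContinuousSMul ℂ HolClosedDisc _ _ τ ∧
    @LocallyConvexSpace ℝ HolClosedDisc _ _ _ (Module.complexToReal HolClosedDisc) τ ∧
    ∀ (U : TopologicalSpace.Opens ℂ) (hU : Metric.closedBall (0 : ℂ) 1 ⊆ (U : Set ℂ)),
      @Continuous (Hol U) HolClosedDisc _ τ (restrictToClosedDisc U hU)}

/-- The univalent self-maps of the unit disc. -/
structure IsUnivalentSelfMap (φ : unitDisc → unitDisc) : Prop where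
  holo : IsHolo unitDisc fun z => (φ z : ℂ)
  injective : Function.Injective φ

/-- The holomorphic flows in the unit disc. -/
structure IsHolomorphicFlow (φ : ℝ≥0 → unitDisc → unitDisc) : Prop where
  holo : ∀ t, IsHolo unitDisc fun z => (φ t z : ℂ)
  zero : ∀ z, φ 0 z = z
  add : ∀ t s z, φ (t + s) z = φ t (φ s z)
  continuous : ∀ z, Continuous fun t => φ t z

/-- The disc automorphism `α_r(z) = (z + r) / (1 + r z)`, `0 < r < 1`. -/
noncomputable def alpha (r : Set.Ioo (0 : ℝ) 1) (z : unitDisc) : unitDisc :=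
  ⟨((z : ℂ) + (r : ℝ)) / (1 + (r : ℝ) * z), by
    obtain ⟨r, hr0, hr1⟩ := r
    obtain ⟨z, hz⟩ := z
    have hz1 : ‖z‖ < 1 := by simpa [unitDisc, ← SetLike.mem_coe] using hz
    have hz2 : z.re ^ 2 + z.im ^ 2 < 1 := by
      have h : ‖z‖ ^ 2 < 1 := by nlinarith [norm_nonneg z]
      rw [← Complex.normSq_eq_norm_sq, Complex.normSq_apply] at h
      nlinarith
    have hlt : ‖z + (r : ℂ)‖ < ‖1 + (r : ℂ) * z‖ := by
      refine lt_of_pow_lt_pow_left₀ 2 (norm_nonneg _) ?_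
      rw [← Complex.normSq_eq_norm_sq, ← Complex.normSq_eq_norm_sq, Complex.normSq_apply,
        Complex.normSq_apply]
      simp only [Complex.add_re, Complex.add_im, Complex.ofReal_re, Complex.ofReal_im,
        Complex.mul_re, Complex.mul_im, Complex.one_re, Complex.one_im]
      nlinarith [mul_pos (sub_pos.2 hz2) (show 0 < 1 - r ^ 2 by nlinarith)]
    change _ ∈ Metric.ball (0 : ℂ) 1
    rw [mem_ball_zero_iff, norm_div, div_lt_one ((norm_nonneg _).trans_lt hlt)]
    exact hlt⟩

section

variable {B : Type*} [NormedAddCommGroup B] [NormedSpace ℂ B]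

/-- The condition `𝒪(closed disc) ↪ B ↪ Hol(unit disc)` with both embeddings continuous.
The map `ι` is the inclusion of `B` in `Hol(unit disc)`: it sends an element of `B` to the
function that it is. -/
structure SatisfiesStar (ι : B →ₗ[ℂ] Hol unitDisc) : Prop where
  injective : Function.Injective ι
  continuous : Continuous ι
  closedDisc_embeds : ∃ j : HolClosedDisc →L[ℂ] B,
    ∀ (g : HolClosedDisc) (z : unitDisc), (ι (j g)).1 z = g.eval (toClosedDisc z)

/-- Composition with a univalent self-map of the disc that fixes `0` maps `B` to `B` and does
not increase the norm. -/
def SatisfiesStarStar (ι : B →ₗ[ℂ] Hol unitDisc) : Prop :=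
  ∀ η : unitDisc → unitDisc, IsUnivalentSelfMap η → η discZero = discZero →
    ∀ f : B, ∃ g : B, (∀ z, (ι g).1 z = (ι f).1 (η z)) ∧ ‖g‖ ≤ ‖f‖

/-- The bounded operator `T` on `B` is the composition operator `C_φ f = f ∘ φ`. -/
def IsCompositionOperator (ι : B →ₗ[ℂ] Hol unitDisc) (φ : unitDisc → unitDisc)
    (T : B →L[ℂ] B) : Prop :=
  ∀ (f : B) (z : unitDisc), (ι (T f)).1 z = (ι f).1 (φ z)

/-- One parameter semigroups of bounded operators (without any continuity in `t`). -/
structure IsOperatorSemigroup (T : ℝ≥0 → B →L[ℂ] B) : Prop where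
  zero : T 0 = ContinuousLinearMap.id ℂ B
  add : ∀ t s, T (t + s) = (T t).comp (T s)

/-- `‖T_t‖ ≤ e^{ω t}` for all `t ≥ 0`, with some real `ω`. -/
def IsQuasicontractive (T : ℝ≥0 → B →L[ℂ] B) : Prop :=
  ∃ ω : ℝ, ∀ t : ℝ≥0, ‖T t‖ ≤ Real.exp (ω * t)

/-- `T` is the semigroup of (bounded) composition operators `T_t f = f ∘ φ_t` on `B`. -/
structure IsCompositionSemigroup (ι : B →ₗ[ℂ] Hol unitDisc) (φ : ℝ≥0 → unitDisc → unitDisc)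
    (T : ℝ≥0 → B →L[ℂ] B) : Prop where
  semigroup : IsOperatorSemigroup T
  comp : ∀ t, IsCompositionOperator ι (φ t) (T t)

/-- The operators `C_{α_r}`, `0 < r < 1`, are bounded on `B` and
`‖C_{α_r}‖ ≤ ((1 + r) / (1 - r)) ^ a`. -/
def AlphaEstimate (ι : B →ₗ[ℂ] Hol unitDisc) (a : ℝ) : Prop :=
  ∀ r : Set.Ioo (0 : ℝ) 1, ∃ T : B →L[ℂ] B, IsCompositionOperator ι (alpha r) T ∧
    ‖T‖ ≤ ((1 + (r : ℝ)) / (1 - (r : ℝ))) ^ a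

end

/-! A univalent `φ` with `|φ(0)| = r > 0` factors as a rotation after `α_r` after a univalent `η`
fixing `0`. By (⋆⋆) the rotation and `η` induce contractions, so `‖C_φ‖ ≤ ‖C_{α_r}‖`
(`exists_compositionOperator_of_alpha`). This gives the final estimate, and the sufficiency in (i)
once flow maps are known to be injective. Conversely, the maps `α_r` with `e^t = (1 + r)/(1 - r)`
are the positive times of a single flow, `hyperbolicFlow`. Testing the hypothesis on it gives
necessity in both (i) and (ii), since a bound `e^{ωt}` becomes a power of `(1 + r)/(1 - r)`. For
sufficiency in (ii), `|φ_s(0)| = O(s)` turns the norm estimate into `e^{ωs}` for small `s`, and the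
semigroup law extends it to all times. Injectivity and this linear speed both come from
`exists_norm_sub_sub_le`: near a given point, `φ_s - id` has Lipschitz constant at most `1/2` for
small `s`. No infinitesimal generator is needed. -/

/-! ### Univalent self-maps and their factorization through `alpha`. -/

theorem mem_unitDisc_iff {z : ℂ} : z ∈ unitDisc ↔ ‖z‖ < 1 := mem_ball_zero_iff

theorem unitDisc_norm_lt_one (z : unitDisc) : ‖(z : ℂ)‖ < 1 := mem_unitDisc_iff.1 z.2

theorem IsHolo.comp_selfMap {f : unitDisc → ℂ} {φ : unitDisc → unitDisc} (hf : IsHolo unitDisc f)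
    (hφ : IsHolo unitDisc fun z => (φ z : ℂ)) : IsHolo unitDisc fun z => f (φ z) := by
  obtain ⟨F, hF, hFf⟩ := hf
  obtain ⟨G, hG, hGg⟩ := hφ
  refine ⟨F ∘ G, hF.comp hG fun z hz => ?_, fun z => ?_⟩
  · have h := hGg ⟨z, hz⟩
    exact h ▸ (φ ⟨z, hz⟩).2
  · simp only [Function.comp, hGg, hFf]

theorem IsUnivalentSelfMap.comp {φ ψ : unitDisc → unitDisc} (hφ : IsUnivalentSelfMap φ)
    (hψ : IsUnivalentSelfMap ψ) : IsUnivalentSelfMap (φ ∘ ψ) :=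
  ⟨hφ.holo.comp_selfMap hψ.holo, hφ.injective.comp hψ.injective⟩

/-- Multiplication by a unimodular number, as a self-map of the disc. -/
def discRotation (u : ℂ) (hu : ‖u‖ = 1) (z : unitDisc) : unitDisc :=
  ⟨u * z, by rw [mem_unitDisc_iff, norm_mul, hu, one_mul]; exact unitDisc_norm_lt_one z⟩

theorem discRotation_isUnivalent (u : ℂ) (hu : ‖u‖ = 1) : IsUnivalentSelfMap (discRotation u hu) := by
  refine ⟨⟨fun z => u * z, (differentiable_id.const_mul u).differentiableOn, fun _ => rfl⟩, ?_⟩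
  intro z w h
  have hu0 : u ≠ 0 := by rintro rfl; simp at hu
  exact Subtype.ext (mul_left_cancel₀ hu0 (congrArg Subtype.val h))

theorem discRotation_discZero (u : ℂ) (hu : ‖u‖ = 1) : discRotation u hu discZero = discZero :=
  Subtype.ext (mul_zero u)

theorem one_add_mul_ne_zero_of_norm_lt {r z : ℂ} (hr : ‖r‖ < 1) (hz : ‖z‖ < 1) :
    1 + r * z ≠ 0 := by
  intro h
  have h1 : r * z = -1 := by linear_combination h
  have h2 : ‖r‖ * ‖z‖ = 1 := by rw [← norm_mul, h1, norm_neg, norm_one]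
  nlinarith [norm_nonneg r, norm_nonneg z]

theorem norm_ofReal_lt_one (r : Set.Ioo (0 : ℝ) 1) : ‖((r : ℝ) : ℂ)‖ < 1 := by
  rw [Complex.norm_real, Real.norm_of_nonneg r.2.1.le]
  exact r.2.2

theorem alpha_isHolo (r : Set.Ioo (0 : ℝ) 1) : IsHolo unitDisc fun z => (alpha r z : ℂ) := by
  refine ⟨fun z => (z + (r : ℝ)) / (1 + (r : ℝ) * z), ?_, fun _ => rfl⟩
  refine DifferentiableOn.div (by fun_prop) (by fun_prop) fun z hz => ?_
  exact one_add_mul_ne_zero_of_norm_lt (norm_ofReal_lt_one r) (mem_unitDisc_iff.1 hz)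

/-- The map `z ↦ -z` of the disc. -/
def discNeg : unitDisc → unitDisc := discRotation (-1) (by simp)

/-- The inverse of `α_r` is `z ↦ -α_r(-z)`; this form avoids negative parameters. -/
theorem alpha_discNeg_alpha (r : Set.Ioo (0 : ℝ) 1) (z : unitDisc) :
    alpha r (discNeg (alpha r z)) = discNeg z := by
  apply Subtype.ext
  have h1 := one_add_mul_ne_zero_of_norm_lt (norm_ofReal_lt_one r) (unitDisc_norm_lt_one z)
  have h2 := one_add_mul_ne_zero_of_norm_lt (norm_ofReal_lt_one r)
    (unitDisc_norm_lt_one (discNeg (alpha r z)))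
  simp only [alpha, discNeg, discRotation] at h2 ⊢
  rw [div_eq_iff h2]
  generalize (z : ℂ) = w at h1 ⊢
  generalize ((r : ℝ) : ℂ) = c at h1 ⊢
  have h3 : 1 + w * c ≠ 0 := by rwa [mul_comm]
  field_simp
  ring

theorem discNeg_discNeg (z : unitDisc) : discNeg (discNeg z) = z := by
  apply Subtype.ext
  simp [discNeg, discRotation]

theorem alpha_isUnivalent (r : Set.Ioo (0 : ℝ) 1) : IsUnivalentSelfMap (alpha r) := by
  refine ⟨alpha_isHolo r, fun z w h => ?_⟩
  have h' := congrArg (fun y => alpha r (discNeg y)) h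
  simp only [alpha_discNeg_alpha] at h'
  exact (discRotation_isUnivalent _ _).injective h'

/-- With `u = φ(0)/r`, the map `u⁻¹φ` sends `0` to `r = α_r(0)`, so `η = α_r⁻¹ ∘ u⁻¹φ` fixes `0`. -/
theorem IsUnivalentSelfMap.exists_eq_discRotation_alpha_comp {φ : unitDisc → unitDisc}
    (hφ : IsUnivalentSelfMap φ) (r : Set.Ioo (0 : ℝ) 1) (hr : ‖(φ discZero : ℂ)‖ = r) :
    ∃ (u : ℂ) (hu : ‖u‖ = 1) (η : unitDisc → unitDisc), IsUnivalentSelfMap η ∧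
      η discZero = discZero ∧ φ = discRotation u hu ∘ alpha r ∘ η := by
  have hr0 : ((r : ℝ) : ℂ) ≠ 0 := by exact_mod_cast r.2.1.ne'
  set b : ℂ := (φ discZero : ℂ) with hb
  have hu : ‖b / (r : ℝ)‖ = 1 := by
    rw [norm_div, hr, Complex.norm_real, Real.norm_of_nonneg r.2.1.le, div_self r.2.1.ne']
  have hu0 : b / (r : ℝ) ≠ 0 := by rintro h; simp [h] at hu
  have hv : ‖(b / (r : ℝ))⁻¹‖ = 1 := by rw [norm_inv, hu, inv_one]
  refine ⟨b / (r : ℝ), hu, discNeg ∘ alpha r ∘ discNeg ∘ discRotation _ hv ∘ φ, ?_, ?_, ?_⟩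
  · exact (discRotation_isUnivalent _ _).comp ((alpha_isUnivalent r).comp
      ((discRotation_isUnivalent _ _).comp ((discRotation_isUnivalent _ _).comp hφ)))
  · apply Subtype.ext
    simp only [Function.comp, discNeg, discRotation, alpha, discZero]
    have hb0 : b ≠ 0 := fun h => hu0 (by rw [h, zero_div])
    change -1 * ((-1 * ((b / (r : ℝ))⁻¹ * b) + _) / _) = (0 : ℂ)
    rw [inv_div, div_mul_cancel₀ _ hb0]
    simp
  · funext z
    simp only [Function.comp]
    rw [alpha_discNeg_alpha, discNeg_discNeg]
    exact Subtype.ext (mul_inv_cancel_left₀ hu0 _).symm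

/-! ### Composition operators with univalent symbols. -/

section

variable {B : Type*} [NormedAddCommGroup B] [NormedSpace ℂ B] {ι : B →ₗ[ℂ] Hol unitDisc}

theorem eq_of_inclusion_apply_eq (hι : Function.Injective ι) {f g : B}
    (h : ∀ z, (ι f).1 z = (ι g).1 z) : f = g :=
  hι (Subtype.ext (ContinuousMap.ext h))

theorem SatisfiesStarStar.exists_compositionOperator (hι : Function.Injective ι)
    (hs : SatisfiesStarStar ι) {η : unitDisc → unitDisc} (hη : IsUnivalentSelfMap η)
    (h0 : η discZero = discZero) :
    ∃ T : B →L[ℂ] B, IsCompositionOperator ι η T ∧ ‖T‖ ≤ 1 := by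
  choose T hT hTn using hs η hη h0
  let L : B →ₗ[ℂ] B :=
    { toFun := T
      map_add' := fun f g => eq_of_inclusion_apply_eq hι fun z => by
        rw [hT, map_add, map_add]
        change _ = (ι (T f)).1 z + (ι (T g)).1 z
        rw [hT, hT]; rfl
      map_smul' := fun c f => eq_of_inclusion_apply_eq hι fun z => by
        rw [hT, map_smul, map_smul]
        change _ = c • (ι (T f)).1 z
        rw [hT]; rfl }
  refine ⟨L.mkContinuous 1 fun f => (hTn f).trans_eq (one_mul _).symm, fun f z => hT f z, ?_⟩
  exact L.mkContinuous_norm_le zero_le_one _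

theorem IsCompositionOperator.comp {φ ψ : unitDisc → unitDisc} {T S : B →L[ℂ] B}
    (hT : IsCompositionOperator ι φ T) (hS : IsCompositionOperator ι ψ S) :
    IsCompositionOperator ι (φ ∘ ψ) (S.comp T) := fun f z => by
  simp only [ContinuousLinearMap.comp_apply, Function.comp]
  rw [hS, hT]

theorem IsCompositionOperator.unique (hι : Function.Injective ι) {φ : unitDisc → unitDisc}
    {T S : B →L[ℂ] B} (hT : IsCompositionOperator ι φ T) (hS : IsCompositionOperator ι φ S) :
    T = S :=
  ContinuousLinearMap.ext fun f => eq_of_inclusion_apply_eq hι fun z => by rw [hT, hS]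

theorem IsCompositionOperator.isCompositionSemigroup (hι : Function.Injective ι)
    {φ : ℝ≥0 → unitDisc → unitDisc} (hφ : IsHolomorphicFlow φ) {T : ℝ≥0 → B →L[ℂ] B}
    (hT : ∀ t, IsCompositionOperator ι (φ t) (T t)) : IsCompositionSemigroup ι φ T := by
  refine ⟨⟨(hT 0).unique hι fun f z => ?_, fun t s => (hT _).unique hι fun f z => ?_⟩, hT⟩
  · rw [hφ.zero]; rfl
  -- Passing from symbols to operators reverses the order of composition, hence the exchange of `t`
  -- and `s`.
  · rw [add_comm, hφ.add]
    exact ((hT s).comp (hT t)) f z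

/-- A composition operator with a univalent symbol is controlled by the one with symbol
`alpha r`, where `r` is the modulus of the image of the centre. -/
theorem exists_compositionOperator_of_alpha (hι : Function.Injective ι)
    (hs : SatisfiesStarStar ι) {φ : unitDisc → unitDisc} (hφ : IsUnivalentSelfMap φ)
    (r : Set.Ioo (0 : ℝ) 1) (hr : ‖(φ discZero : ℂ)‖ = r) {A : B →L[ℂ] B}
    (hA : IsCompositionOperator ι (alpha r) A) :
    ∃ T : B →L[ℂ] B, IsCompositionOperator ι φ T ∧ ‖T‖ ≤ ‖A‖ := by
  obtain ⟨u, hu, η, hη, hη0, rfl⟩ := hφ.exists_eq_discRotation_alpha_comp r hr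
  obtain ⟨R, hR, hRn⟩ := hs.exists_compositionOperator hι (discRotation_isUnivalent u hu)
    (discRotation_discZero u hu)
  obtain ⟨E, hE, hEn⟩ := hs.exists_compositionOperator hι hη hη0
  refine ⟨(E.comp A).comp R, hR.comp (hA.comp hE), ?_⟩
  calc ‖(E.comp A).comp R‖ ≤ ‖E.comp A‖ * ‖R‖ := ContinuousLinearMap.opNorm_comp_le _ _
    _ ≤ ‖E.comp A‖ * 1 := by gcongr
    _ ≤ ‖E‖ * ‖A‖ := by rw [mul_one]; exact ContinuousLinearMap.opNorm_comp_le _ _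
    _ ≤ 1 * ‖A‖ := by gcongr
    _ = ‖A‖ := one_mul _

theorem exists_compositionOperator_of_univalent (hι : Function.Injective ι)
    (hs : SatisfiesStarStar ι)
    (hα : ∀ r : Set.Ioo (0 : ℝ) 1, ∃ T : B →L[ℂ] B, IsCompositionOperator ι (alpha r) T)
    {φ : unitDisc → unitDisc} (hφ : IsUnivalentSelfMap φ) :
    ∃ T : B →L[ℂ] B, IsCompositionOperator ι φ T := by
  rcases (norm_nonneg (φ discZero : ℂ)).eq_or_lt with h | h
  · obtain ⟨T, hT, -⟩ := hs.exists_compositionOperator hι hφ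
      (Subtype.ext (norm_eq_zero.1 h.symm))
    exact ⟨T, hT⟩
  · obtain ⟨A, hA⟩ := hα ⟨_, h, unitDisc_norm_lt_one _⟩
    obtain ⟨T, hT, -⟩ := exists_compositionOperator_of_alpha hι hs hφ _ rfl hA
    exact ⟨T, hT⟩

theorem AlphaEstimate.exists_compositionOperator (hι : Function.Injective ι)
    (hs : SatisfiesStarStar ι) {a : ℝ} (hα : AlphaEstimate ι a)
    {φ : unitDisc → unitDisc} (hφ : IsUnivalentSelfMap φ) :
    ∃ T : B →L[ℂ] B, IsCompositionOperator ι φ T ∧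
      ‖T‖ ≤ ((1 + ‖(φ discZero : ℂ)‖) / (1 - ‖(φ discZero : ℂ)‖)) ^ a := by
  rcases (norm_nonneg (φ discZero : ℂ)).eq_or_lt with h | h
  · obtain ⟨T, hT, hTn⟩ := hs.exists_compositionOperator hι hφ
      (Subtype.ext (norm_eq_zero.1 h.symm))
    exact ⟨T, hT, by simpa [← h] using hTn⟩
  · obtain ⟨A, hA, hAn⟩ := hα ⟨_, h, unitDisc_norm_lt_one _⟩
    obtain ⟨T, hT, hTn⟩ := exists_compositionOperator_of_alpha hι hs hφ _ rfl hA
    exact ⟨T, hT, hTn.trans hAn⟩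

end

/-! ### Local behaviour of flows: injectivity and speed at the centre. -/

/-- A function bounded on a disc, and small at two points near the centre, has a small Lipschitz
constant near the centre. -/
theorem norm_sub_le_of_bounded_on_ball {g : ℂ → ℂ} {w : ℂ} {R ρ : ℝ} (hρ : 0 < ρ)
    (hρR : ρ ≤ R / 4) (hg : DifferentiableOn ℂ g (Metric.ball w R))
    (hb : ∀ z ∈ Metric.ball w R, ‖g z‖ ≤ 2) {z₁ z₂ : ℂ} (h₁ : z₁ ∈ Metric.ball w ρ)
    (h₂ : z₂ ∈ Metric.ball w ρ) :
    ‖g z₁ - g z₂‖ ≤ (32 / R ^ 2 * ρ + 2 / ρ * (‖g (w + ρ / 2)‖ + ‖g w‖)) * ‖z₁ - z₂‖ := by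
  have hR : 0 < R := by linarith
  have hd : DifferentiableOn ℂ (deriv g) (Metric.ball w R) := hg.deriv Metric.isOpen_ball
  have hball : ∀ {z s r}, z ∈ Metric.ball w s → s + r ≤ R →
      Metric.closedBall z r ⊆ Metric.ball w R := fun {z s r} hz h y hy => by
    rw [Metric.mem_ball] at hz ⊢
    rw [Metric.mem_closedBall] at hy
    linarith [dist_triangle y z w]
  -- Two Cauchy estimates, each losing part of the radius, bound `g'` by `4/R` and then `g''` by
  -- `16/R²`.
  have hd1 : ∀ z ∈ Metric.ball w (R / 2), ‖deriv g z‖ ≤ 2 / (R / 2) := fun z hz => by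
    have hsub := hball (r := R / 2) hz (by linarith)
    refine Complex.norm_deriv_le_of_forall_mem_sphere_norm_le (by positivity)
      ((hg.mono ?_).diffContOnCl) fun y hy => hb y (hsub (Metric.sphere_subset_closedBall hy))
    rw [closure_ball _ (by positivity)]
    exact hsub
  have hd2 : ∀ z ∈ Metric.ball w (R / 4), ‖deriv (deriv g) z‖ ≤ 16 / R ^ 2 := fun z hz => by
    have hsub := hball (r := R / 4) hz (by linarith)
    have : ‖deriv (deriv g) z‖ ≤ (2 / (R / 2)) / (R / 4) := by
      refine Complex.norm_deriv_le_of_forall_mem_sphere_norm_le (by positivity)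
        ((hd.mono ?_).diffContOnCl) fun y hy => hd1 y ?_
      · rw [closure_ball _ (by positivity)]
        exact hsub
      · rw [Metric.mem_sphere] at hy
        rw [Metric.mem_ball] at hz ⊢
        linarith [dist_triangle y z w]
    refine this.trans_eq ?_
    field_simp
    norm_num
  have hsubρ : Metric.ball w ρ ⊆ Metric.ball w (R / 4) := Metric.ball_subset_ball hρR
  have hsubR : Metric.ball w ρ ⊆ Metric.ball w R := Metric.ball_subset_ball (by linarith)
  have hw : w ∈ Metric.ball w ρ := Metric.mem_ball_self hρ
  have hat : ∀ z ∈ Metric.ball w ρ, Metric.ball w R ∈ nhds z := fun z hz =>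
    Metric.isOpen_ball.mem_nhds (hsubR hz)
  have hd3 : ∀ z ∈ Metric.ball w ρ, ‖deriv g z - deriv g w‖ ≤ 16 / R ^ 2 * ρ := fun z hz => by
    have := (convex_ball w ρ).norm_image_sub_le_of_norm_deriv_le (𝕜 := ℂ) (f := deriv g)
      (fun y hy => hd.differentiableAt (hat y hy)) (fun y hy => hd2 y (hsubρ hy)) hw hz
    refine this.trans ?_
    gcongr
    exact (mem_ball_iff_norm.1 hz).le
  have hd4 : ∀ x ∈ Metric.ball w ρ, ∀ y ∈ Metric.ball w ρ,
      ‖g y - g x - deriv g w * (y - x)‖ ≤ 16 / R ^ 2 * ρ * ‖y - x‖ := fun x hx y hy => by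
    have := (convex_ball w ρ).norm_image_sub_le_of_norm_hasDerivWithin_le (𝕜 := ℂ)
      (f := fun z => g z - deriv g w * z) (f' := fun z => deriv g z - deriv g w * 1)
      (C := 16 / R ^ 2 * ρ)
      (fun z hz => (((hg.differentiableAt (hat z hz)).hasDerivAt).sub
        ((hasDerivAt_id z).const_mul _)).hasDerivWithinAt)
      (fun z hz => by simpa using hd3 z hz) hx hy
    rw [show g y - g x - deriv g w * (y - x) =
      (g y - deriv g w * y) - (g x - deriv g w * x) by ring]
    exact this
  have hρ2 : ‖(ρ : ℂ) / 2‖ = ρ / 2 := by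
    rw [norm_div, Complex.norm_real, Real.norm_of_nonneg hρ.le]
    norm_num
  have hp : w + ρ / 2 ∈ Metric.ball w ρ := by
    rw [mem_ball_iff_norm, add_sub_cancel_left, hρ2]
    linarith
  -- The difference quotient between `w` and `w + ρ/2` controls `g'(w)` by two values of `g`, up to
  -- the error in `hd4`.
  have hD : ‖deriv g w‖ ≤ 16 / R ^ 2 * ρ + 2 / ρ * (‖g (w + ρ / 2)‖ + ‖g w‖) := by
    have h := hd4 w hw _ hp
    rw [add_sub_cancel_left, hρ2] at h
    have h' : ‖deriv g w * (ρ / 2)‖ ≤ ‖g (w + ρ / 2)‖ + ‖g w‖ + 16 / R ^ 2 * ρ * (ρ / 2) := by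
      have e : deriv g w * (ρ / 2) =
        (g (w + ρ / 2) - g w) - (g (w + ρ / 2) - g w - deriv g w * (ρ / 2)) := by ring
      rw [e]
      exact (norm_sub_le _ _).trans (add_le_add (norm_sub_le _ _) h)
    rw [norm_mul, hρ2, ← le_div_iff₀ (by positivity)] at h'
    refine h'.trans_eq ?_
    generalize ‖g (w + ρ / 2)‖ + ‖g w‖ = M
    field_simp
    ring
  have e : g z₁ - g z₂ = (g z₁ - g z₂ - deriv g w * (z₁ - z₂)) + deriv g w * (z₁ - z₂) := by ring
  rw [e]
  refine (norm_add_le _ _).trans ?_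
  rw [norm_mul]
  have h := hd4 z₂ h₂ z₁ h₁
  have := mul_le_mul_of_nonneg_right hD (norm_nonneg (z₁ - z₂))
  have e2 : 32 / R ^ 2 * ρ = 16 / R ^ 2 * ρ + 16 / R ^ 2 * ρ := by ring
  rw [e2]
  linarith

/-- The maps of a flow are close to the identity near every point, for small times. -/
theorem IsHolomorphicFlow.exists_norm_sub_sub_le {φ : ℝ≥0 → unitDisc → unitDisc}
    (hφ : IsHolomorphicFlow φ) (w : unitDisc) :
    ∃ ρ > 0, ∃ δ > 0, ∀ s ≤ δ, ∀ z₁ z₂ : unitDisc, dist z₁ w < ρ → dist z₂ w < ρ →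
      ‖((φ s z₁ : ℂ) - φ s z₂) - (z₁ - z₂)‖ ≤ 1 / 2 * ‖(z₁ : ℂ) - z₂‖ := by
  obtain ⟨R, hR, hwR⟩ := Metric.isOpen_iff.1 unitDisc.isOpen (w : ℂ) w.2
  -- The Lipschitz constant `1/2` is split evenly: `ρ` makes the second-derivative term at most
  -- `1/4`, and then `δ` makes the term with the two values less than `1/4`.
  obtain ⟨ρ, hρ, hρR, hρR2⟩ : ∃ ρ : ℝ, 0 < ρ ∧ ρ ≤ R / 4 ∧ 32 / R ^ 2 * ρ ≤ 1 / 4 := by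
    refine ⟨min (R / 4) (R ^ 2 / 128), by positivity, min_le_left _ _, ?_⟩
    calc 32 / R ^ 2 * min (R / 4) (R ^ 2 / 128) ≤ 32 / R ^ 2 * (R ^ 2 / 128) := by
          gcongr; exact min_le_right _ _
      _ = 1 / 4 := by field_simp; norm_num
  have hp : (w : ℂ) + ρ / 2 ∈ unitDisc := by
    apply hwR
    rw [mem_ball_iff_norm, add_sub_cancel_left, norm_div, Complex.norm_real,
      Real.norm_of_nonneg hρ.le]
    norm_num
    linarith
  have hlim : ∀ z : unitDisc, Filter.Tendsto (fun s => ‖(φ s z : ℂ) - z‖) (nhds 0) (nhds 0) := by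
    intro z
    have h : Continuous fun s => ‖(φ s z : ℂ) - z‖ := by
      have := hφ.continuous z
      fun_prop
    simpa [hφ.zero] using h.tendsto 0
  have hsum : Filter.Tendsto (fun s => 2 / ρ * (‖(φ s ⟨_, hp⟩ : ℂ) - (w + ρ / 2)‖ +
      ‖(φ s w : ℂ) - w‖)) (nhds 0) (nhds 0) := by
    simpa using ((hlim ⟨_, hp⟩).add (hlim w)).const_mul (2 / ρ)
  obtain ⟨δ, hδ, hδs⟩ := Metric.eventually_nhds_iff.1
    (hsum.eventually_lt_const (show (0 : ℝ) < 1 / 4 by norm_num))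
  refine ⟨ρ, hρ, ⟨δ / 2, by positivity⟩, NNReal.coe_pos.1 (half_pos hδ),
    fun s hs z₁ z₂ h₁ h₂ => ?_⟩
  have hs' : (s : ℝ) ≤ δ / 2 := hs
  have hsm := hδs (y := s) (by
    rw [NNReal.dist_eq, NNReal.coe_zero, sub_zero, abs_of_nonneg s.coe_nonneg]
    linarith)
  obtain ⟨F, hF, hFf⟩ := hφ.holo s
  have key := norm_sub_le_of_bounded_on_ball (g := fun z => F z - z) (w := w) hρ hρR
    ((hF.mono hwR).sub differentiableOn_id) (fun z hz => ?_) (z₁ := z₁) (z₂ := z₂) h₁ h₂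
  · have e := hFf ⟨_, hp⟩
    simp only at e
    simp only [hFf, e] at key
    rw [show ((φ s z₁ : ℂ) - φ s z₂) - (z₁ - z₂) = (φ s z₁ : ℂ) - z₁ - (φ s z₂ - z₂) by ring]
    refine key.trans ?_
    gcongr
    linarith
  · have hzD : z ∈ unitDisc := hwR hz
    have e := hFf ⟨z, hzD⟩
    have h1 : ‖F z‖ < 1 := by
      rw [show F z = _ from e]
      exact mem_ball_zero_iff.1 (φ s ⟨z, hzD⟩).2
    have h2 : ‖z‖ < 1 := mem_ball_zero_iff.1 hzD
    linarith [norm_sub_le (F z) z]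

/-- Let `τ` be the first time at which two orbits meet. Shortly before `τ` both are near the meeting
point, where `φ_s` is injective for small `s`; so they already coincide at time `τ - s`. -/
theorem IsHolomorphicFlow.injective {φ : ℝ≥0 → unitDisc → unitDisc}
    (hφ : IsHolomorphicFlow φ) (t : ℝ≥0) : Function.Injective (φ t) := by
  intro z₁ z₂ h
  by_contra hne
  set S : Set ℝ≥0 := {t | φ t z₁ = φ t z₂} with hS
  have hcl : IsClosed S := isClosed_eq (hφ.continuous z₁) (hφ.continuous z₂)
  have hmem : sInf S ∈ S := hcl.csInf_mem ⟨t, h⟩ (OrderBot.bddBelow S)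
  set τ := sInf S with hτ
  have hτ0 : 0 < τ := by
    refine pos_iff_ne_zero.2 fun h0 => hne ?_
    rw [h0] at hmem
    simpa [hS, hφ.zero] using hmem
  obtain ⟨ρ, hρ, δ, hδ, hs⟩ := hφ.exists_norm_sub_sub_le (φ τ z₁)
  have hc : ∀ z, φ τ z = φ τ z₁ → ∀ᶠ s in nhds (0 : ℝ≥0), dist (φ (τ - s) z) (φ τ z₁) < ρ := by
    intro z hz
    have : Continuous fun s => φ (τ - s) z := (hφ.continuous z).comp (by fun_prop)
    have := this.tendsto 0
    rw [tsub_zero, hz] at this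
    exact this (Metric.ball_mem_nhds _ hρ)
  have hev := ((hc z₁ rfl).and (hc z₂ hmem.symm)).and
    ((eventually_le_nhds hδ).and (eventually_le_nhds hτ0))
  have : (nhdsWithin (0 : ℝ≥0) (Set.Ioi 0)).NeBot := nhdsGT_neBot 0
  obtain ⟨s, ⟨⟨⟨h1, h2⟩, hsδ, hsτ⟩, hs0⟩⟩ :=
    ((hev.filter_mono nhdsWithin_le_nhds).and
      (self_mem_nhdsWithin : Set.Ioi (0 : ℝ≥0) ∈ nhdsWithin 0 (Set.Ioi 0))).exists
  have hφs : ∀ z, φ s (φ (τ - s) z) = φ τ z := fun z => by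
    rw [← hφ.add, add_tsub_cancel_of_le hsτ]
  have key := hs s hsδ _ _ h1 h2
  rw [hφs, hφs, show φ τ z₁ = φ τ z₂ from hmem, sub_self, zero_sub, norm_neg] at key
  have : τ - s ∈ S := by
    refine Subtype.ext (sub_eq_zero.1 (norm_eq_zero.1 ?_))
    linarith [norm_nonneg ((φ (τ - s) z₁ : ℂ) - φ (τ - s) z₂)]
  exact (tsub_lt_self hτ0 hs0).not_ge (csInf_le (OrderBot.bddBelow S) this)

theorem IsHolomorphicFlow.isUnivalentSelfMap {φ : ℝ≥0 → unitDisc → unitDisc}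
    (hφ : IsHolomorphicFlow φ) (t : ℝ≥0) : IsUnivalentSelfMap (φ t) :=
  ⟨hφ.holo t, hφ.injective t⟩

/-- The orbit of the centre leaves it at most at linear speed. -/
theorem IsHolomorphicFlow.exists_norm_discZero_le {φ : ℝ≥0 → unitDisc → unitDisc}
    (hφ : IsHolomorphicFlow φ) :
    ∃ δ : ℝ≥0, 0 < δ ∧ ∀ s ≤ δ, ‖(φ s discZero : ℂ)‖ ≤ 4 * (s / δ) := by
  obtain ⟨ρ, hρ, δ₁, hδ₁, hs⟩ := hφ.exists_norm_sub_sub_le discZero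
  obtain ⟨δ₂, hδ₂, hnear⟩ : ∃ δ₂ > 0, ∀ s : ℝ≥0, s ≤ δ₂ → dist (φ s discZero) discZero < ρ := by
    have h := (hφ.continuous discZero).tendsto 0
    rw [hφ.zero] at h
    obtain ⟨ε, hε, h⟩ := Metric.eventually_nhds_iff.1 (h (Metric.ball_mem_nhds _ hρ))
    refine ⟨⟨ε / 2, by positivity⟩, NNReal.coe_pos.1 (half_pos hε), fun s hs => h ?_⟩
    have hs' : (s : ℝ) ≤ ε / 2 := hs
    rw [NNReal.dist_eq, NNReal.coe_zero, sub_zero, abs_of_nonneg s.coe_nonneg]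
    linarith
  refine ⟨min δ₁ δ₂, lt_min hδ₁ hδ₂, fun s hsδ => ?_⟩
  set δ := min δ₁ δ₂ with hδ
  have hδ0 : (0 : ℝ) < δ := NNReal.coe_pos.2 (lt_min hδ₁ hδ₂)
  rcases (zero_le : 0 ≤ s).eq_or_lt with rfl | hs0
  · simp [hφ.zero, discZero]
  have hs0' : (0 : ℝ) < s := NNReal.coe_pos.2 hs0
  -- The Lipschitz estimate for `φ_{ns}` at the pair `φ_s(0)`, `0` shows that each increment of the
  -- orbit differs from `φ_s(0)` by at most `|φ_s(0)|/2`; the increments then telescope.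
  have hstep : ∀ n : ℕ, (n : ℝ≥0) * s ≤ δ →
      ‖(φ (n * s) discZero : ℂ) - n * φ s discZero‖ ≤ n * (1 / 2 * ‖(φ s discZero : ℂ)‖) := by
    intro n
    induction n with
    | zero => simp [hφ.zero, discZero]
    | succ n ih =>
      intro hn
      have hn' : (n : ℝ≥0) * s ≤ δ := le_trans (by push_cast; gcongr; simp) hn
      have h1 := hs (n * s) (hn'.trans (min_le_left _ _)) (φ s discZero) discZero
        (hnear s (hsδ.trans (min_le_right _ _))) (by simpa using hρ)
      rw [← hφ.add] at h1
      have e0 : ((discZero : unitDisc) : ℂ) = 0 := rfl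
      rw [e0, sub_zero] at h1
      have e : ((n + 1 : ℕ) : ℝ≥0) * s = n * s + s := by push_cast; ring
      rw [e]
      have e2 : (φ (n * s + s) discZero : ℂ) - ((n + 1 : ℕ) : ℂ) * φ s discZero =
        ((φ (n * s) discZero : ℂ) - n * φ s discZero) +
        ((φ (n * s + s) discZero : ℂ) - φ (n * s) discZero - φ s discZero) := by
        push_cast; ring
      rw [e2]
      refine (norm_add_le _ _).trans ((add_le_add (ih hn') h1).trans_eq ?_)
      push_cast; ring
  -- After `n` steps the orbit is still in the unit disc, so `n * |φ_s(0)| / 2 < 1`; and `δ/s < n +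
  -- 1 ≤ 2n`. Together these give the constant `4`.
  set n := ⌊(δ : ℝ) / s⌋₊ with hn
  have hq : (1 : ℝ) ≤ δ / s := (one_le_div hs0').2 hsδ
  have hn1 : (1 : ℝ) ≤ n := by exact_mod_cast Nat.one_le_floor_iff _ |>.2 hq
  have hnlt : (δ : ℝ) / s < n + 1 := Nat.lt_floor_add_one _
  have hnle : (n : ℝ) * s ≤ δ := by
    rw [← le_div_iff₀ hs0']
    exact Nat.floor_le (by positivity)
  have key := hstep n (by exact_mod_cast hnle)
  have h1 : ‖(φ (n * s) discZero : ℂ)‖ < 1 := mem_ball_zero_iff.1 (φ (n * s) discZero).2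
  have h2 : (n : ℝ) * ‖(φ s discZero : ℂ)‖ - ‖(φ (n * s) discZero : ℂ)‖ ≤
      n * (1 / 2 * ‖(φ s discZero : ℂ)‖) := by
    refine le_trans ?_ key
    rw [norm_sub_rev]
    refine le_trans (le_of_eq ?_) (norm_sub_norm_le _ _)
    rw [norm_mul, Complex.norm_natCast]
  set x := ‖(φ s discZero : ℂ)‖
  have hx : 0 ≤ x := norm_nonneg _
  have h3 : (δ : ℝ) / s ≤ 2 * n := by linarith
  have h4 : (δ : ℝ) / s * x ≤ 4 := by nlinarith [mul_le_mul_of_nonneg_right h3 hx]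
  calc x = (s / δ) * (δ / s * x) := by field_simp
    _ ≤ (s / δ) * 4 := by gcongr
    _ = 4 * (s / δ) := mul_comm _ _

/-! ### The hyperbolic flow. -/

theorem one_add_div_one_sub_pos {r : ℝ} (h0 : 0 ≤ r) (h1 : r < 1) : 0 < (1 + r) / (1 - r) :=
  div_pos (by linarith) (by linarith)

theorem expRatio_mem {t : ℝ} (ht : 0 < t) :
    (Real.exp t - 1) / (Real.exp t + 1) ∈ Set.Ioo (0 : ℝ) 1 := by
  have h : 1 < Real.exp t := Real.one_lt_exp_iff.2 ht
  refine ⟨div_pos (by linarith) (by linarith), ?_⟩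
  rw [div_lt_one (by linarith)]
  linarith

/-- The hyperbolic flow with fixed points `1` and `-1`, which consists of the maps `alpha r`. -/
noncomputable def hyperbolicFlow (t : ℝ≥0) (z : unitDisc) : unitDisc :=
  if h : 0 < (t : ℝ) then alpha ⟨_, expRatio_mem h⟩ z else z

theorem hyperbolicFlow_of_pos {t : ℝ≥0} (h : 0 < (t : ℝ)) :
    hyperbolicFlow t = alpha ⟨_, expRatio_mem h⟩ :=
  funext fun _ => dif_pos h

theorem hyperbolicFlow_denom_ne_zero (t : ℝ≥0) (z : unitDisc) :
    (Complex.exp (t : ℝ) + 1) + (Complex.exp (t : ℝ) - 1) * z ≠ 0 := by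
  have h1 : (1 : ℝ) ≤ Real.exp t := Real.one_le_exp t.coe_nonneg
  have hz := unitDisc_norm_lt_one z
  intro h
  have e : (((Real.exp t - 1 : ℝ) : ℂ)) * z = -((Real.exp t + 1 : ℝ) : ℂ) := by
    push_cast
    linear_combination h
  have e2 := congrArg norm e
  rw [norm_neg, norm_mul, Complex.norm_real, Complex.norm_real,
    Real.norm_of_nonneg (by linarith), Real.norm_of_nonneg (by linarith)] at e2
  nlinarith [norm_nonneg (z : ℂ)]

/-- This fraction is also valid at `t = 0`, so the flow law and continuity need no case distinction.
-/
theorem hyperbolicFlow_apply (t : ℝ≥0) (z : unitDisc) : (hyperbolicFlow t z : ℂ) =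
    ((Complex.exp (t : ℝ) + 1) * z + (Complex.exp (t : ℝ) - 1)) /
      ((Complex.exp (t : ℝ) + 1) + (Complex.exp (t : ℝ) - 1) * z) := by
  have hd := hyperbolicFlow_denom_ne_zero t z
  rcases t.coe_nonneg.eq_or_lt with h | h
  · simp [hyperbolicFlow, ← h]
  · rw [hyperbolicFlow_of_pos h]
    have hE : Complex.exp (t : ℝ) + 1 ≠ 0 := by
      rw [← Complex.ofReal_exp]
      exact_mod_cast (add_pos (Real.exp_pos t) one_pos).ne'
    simp only [alpha]
    push_cast
    have hd' : 1 + (Complex.exp (t : ℝ) - 1) / (Complex.exp (t : ℝ) + 1) * z ≠ 0 := by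
      intro h
      apply hd
      field_simp at h
      linear_combination h
    rw [div_eq_div_iff hd' hd]
    field_simp

theorem hyperbolicFlow_isHolomorphicFlow : IsHolomorphicFlow hyperbolicFlow where
  holo t := by
    rcases t.coe_nonneg.eq_or_lt with h | h
    · refine ⟨id, differentiableOn_id, fun z => ?_⟩
      simp [hyperbolicFlow, ← h]
    · rw [hyperbolicFlow_of_pos h]
      exact alpha_isHolo _
  zero z := by simp [hyperbolicFlow]
  add t s z := by
    apply Subtype.ext
    have h1 := hyperbolicFlow_denom_ne_zero s z
    have h2 := hyperbolicFlow_denom_ne_zero t (hyperbolicFlow s z)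
    have h3 := hyperbolicFlow_denom_ne_zero (t + s) z
    have hw := (eq_div_iff h1).1 (hyperbolicFlow_apply s z)
    rw [hyperbolicFlow_apply t, hyperbolicFlow_apply (t + s), div_eq_div_iff h3 h2,
      NNReal.coe_add, Complex.ofReal_add, Complex.exp_add]
    linear_combination (-2 * Complex.exp (t : ℝ)) * hw
  continuous z := by
    refine Continuous.subtype_mk (f := fun t => (hyperbolicFlow t z : ℂ)) ?_ _
    simp only [hyperbolicFlow_apply]
    exact Continuous.div (by fun_prop) (by fun_prop) fun t => hyperbolicFlow_denom_ne_zero t z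

theorem exists_hyperbolicFlow_eq_alpha (r : Set.Ioo (0 : ℝ) 1) :
    ∃ t : ℝ≥0, Real.exp t = (1 + (r : ℝ)) / (1 - r) ∧ hyperbolicFlow t = alpha r := by
  have hr0 := r.2.1
  have hr1 : (0 : ℝ) < 1 - r := sub_pos.2 r.2.2
  have hpos := one_add_div_one_sub_pos r.2.1.le r.2.2
  have hlog : 0 < Real.log ((1 + (r : ℝ)) / (1 - r)) :=
    Real.log_pos ((one_lt_div hr1).2 (by linarith))
  obtain ⟨t, ht⟩ : ∃ t : ℝ≥0, (t : ℝ) = Real.log ((1 + (r : ℝ)) / (1 - r)) := ⟨⟨_, hlog.le⟩, rfl⟩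
  have he : Real.exp t = (1 + (r : ℝ)) / (1 - r) := by rw [ht, Real.exp_log hpos]
  refine ⟨t, he, ?_⟩
  rw [hyperbolicFlow_of_pos (ht ▸ hlog)]
  congr 1
  apply Subtype.ext
  change (Real.exp t - 1) / (Real.exp t + 1) = r
  rw [he]
  field_simp
  ring

/-! ### Quasicontractivity from small times. -/

/-- For `0 ≤ x ≤ 1/2`, `(1 + x)/(1 - x) ≤ 1 + 4x ≤ e^{4x}`. -/
theorem one_add_div_one_sub_rpow_le {x a : ℝ} (hx0 : 0 ≤ x) (hx : x ≤ 1 / 2) (ha : 0 ≤ a) :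
    ((1 + x) / (1 - x)) ^ a ≤ Real.exp (4 * x * a) := by
  rw [Real.exp_mul]
  refine Real.rpow_le_rpow (one_add_div_one_sub_pos hx0 (by linarith)).le ?_ ha
  refine le_trans ?_ (Real.add_one_le_exp _)
  rw [div_le_iff₀ (by linarith)]
  nlinarith

section

variable {B : Type*} [NormedAddCommGroup B] [NormedSpace ℂ B] {ι : B →ₗ[ℂ] Hol unitDisc}

theorem IsOperatorSemigroup.norm_nat_mul_le {T : ℝ≥0 → B →L[ℂ] B} (hT : IsOperatorSemigroup T)
    {ω : ℝ} {s : ℝ≥0} (hs : ‖T s‖ ≤ Real.exp (ω * s)) (n : ℕ) :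
    ‖T (n * s)‖ ≤ Real.exp (ω * (n * s : ℝ≥0)) := by
  induction n with
  | zero => simpa [hT.zero] using ContinuousLinearMap.norm_id_le
  | succ n ih =>
    have e : ((n + 1 : ℕ) : ℝ≥0) * s = n * s + s := by push_cast; ring
    rw [e, hT.add, NNReal.coe_add, mul_add, Real.exp_add]
    refine (ContinuousLinearMap.opNorm_comp_le _ _).trans ?_
    gcongr

/-- An exponential bound for small times is a bound for all times. -/
theorem IsOperatorSemigroup.isQuasicontractive_of_le {T : ℝ≥0 → B →L[ℂ] B}
    (hT : IsOperatorSemigroup T) {ω : ℝ} {δ : ℝ≥0} (hδ : 0 < δ)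
    (h : ∀ s ≤ δ, ‖T s‖ ≤ Real.exp (ω * s)) : IsQuasicontractive T := by
  refine ⟨ω, fun t => ?_⟩
  obtain ⟨n, hn⟩ := exists_nat_ge (t / δ)
  -- Dividing `t` into `n + 1` parts, not `n`, keeps the divisor nonzero even when `t = 0`.
  have hn0 : ((n + 1 : ℕ) : ℝ≥0) ≠ 0 := Nat.cast_ne_zero.2 n.succ_ne_zero
  have hle : t / ((n + 1 : ℕ) : ℝ≥0) ≤ δ := by
    rw [div_le_iff₀ (pos_iff_ne_zero.2 hn0), mul_comm]
    rw [div_le_iff₀ hδ] at hn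
    refine hn.trans ?_
    gcongr
    simp
  have := hT.norm_nat_mul_le (h _ hle) (n + 1)
  rwa [mul_div_cancel₀ _ hn0] at this

theorem IsHolomorphicFlow.isQuasicontractive {φ : ℝ≥0 → unitDisc → unitDisc}
    (hφ : IsHolomorphicFlow φ) {a : ℝ} (ha : 0 ≤ a) {T : ℝ≥0 → B →L[ℂ] B}
    (hT : IsOperatorSemigroup T)
    (hTn : ∀ t, ‖T t‖ ≤
      ((1 + ‖(φ t discZero : ℂ)‖) / (1 - ‖(φ t discZero : ℂ)‖)) ^ a) :
    IsQuasicontractive T := by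
  obtain ⟨δ, hδ, h⟩ := hφ.exists_norm_discZero_le
  have hδ' : (0 : ℝ) < δ := NNReal.coe_pos.2 hδ
  -- For `s ≤ δ/8` the linear speed bound gives `|φ_s(0)| ≤ 1/2`; the factor `16` is this bound's
  -- `4` times the `4` in `e^{4xa}`.
  refine hT.isQuasicontractive_of_le (ω := 16 * a / δ) (δ := δ / 8) (by positivity)
    fun s hs => (hTn s).trans ?_
  have hs' : (s : ℝ) ≤ δ / 8 := by exact_mod_cast hs
  have h1 := h s (hs.trans (div_le_self zero_le (by norm_num)))
  have h2 : (s : ℝ) / δ ≤ 1 / 8 := by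
    rw [div_le_iff₀ hδ']
    linarith
  refine (one_add_div_one_sub_rpow_le (norm_nonneg _) (by linarith) ha).trans
    (Real.exp_le_exp.2 ?_)
  calc 4 * ‖(φ s discZero : ℂ)‖ * a ≤ 4 * (4 * (s / δ)) * a := by gcongr
    _ = 16 * a / δ * s := by ring

end

/-! ### The equivalences and the norm estimate. -/

theorem mainTheorem2 {B : Type*} [NormedAddCommGroup B] [NormedSpace ℂ B] [CompleteSpace B]
    (ι : B →ₗ[ℂ] Hol unitDisc) (hstar : SatisfiesStar ι) (hstarstar : SatisfiesStarStar ι) :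
    ((∀ φ : ℝ≥0 → unitDisc → unitDisc, IsHolomorphicFlow φ →
          ∃ T : ℝ≥0 → B →L[ℂ] B, IsCompositionSemigroup ι φ T) ↔
        ∀ r : Set.Ioo (0 : ℝ) 1, ∃ T : B →L[ℂ] B, IsCompositionOperator ι (alpha r) T) ∧
      ((∀ φ : ℝ≥0 → unitDisc → unitDisc, IsHolomorphicFlow φ →
          ∃ T : ℝ≥0 → B →L[ℂ] B, IsCompositionSemigroup ι φ T ∧ IsQuasicontractive T) ↔
        ∃ a : ℝ, 0 ≤ a ∧ AlphaEstimate ι a) ∧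
      (∀ a : ℝ, 0 ≤ a → AlphaEstimate ι a →
        ∀ φ : unitDisc → unitDisc, IsUnivalentSelfMap φ →
          ∃ T : B →L[ℂ] B, IsCompositionOperator ι φ T ∧
            ‖T‖ ≤ ((1 + ‖(φ discZero : ℂ)‖) / (1 - ‖(φ discZero : ℂ)‖)) ^ a) := by
  have hι := hstar.injective
  refine ⟨⟨fun h r => ?_, fun h φ hφ => ?_⟩, ⟨fun h => ?_, ?_⟩, fun a _ hα φ hφ =>
    hα.exists_compositionOperator hι hstarstar hφ⟩
  · obtain ⟨T, hT⟩ := h _ hyperbolicFlow_isHolomorphicFlow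
    obtain ⟨t, -, ht⟩ := exists_hyperbolicFlow_eq_alpha r
    exact ⟨T t, ht ▸ hT.comp t⟩
  · choose T hT using fun t => exists_compositionOperator_of_univalent hι hstarstar h
      (hφ.isUnivalentSelfMap t)
    exact ⟨T, IsCompositionOperator.isCompositionSemigroup hι hφ hT⟩
  · obtain ⟨T, hT, ω, hω⟩ := h _ hyperbolicFlow_isHolomorphicFlow
    -- The exponent must be nonnegative whereas `ω` may be negative; as `t ≥ 0`, replacing `ω` by
    -- `max ω 0` only weakens the bound.
    refine ⟨max ω 0, le_max_right _ _, fun r => ?_⟩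
    obtain ⟨t, hrt, ht⟩ := exists_hyperbolicFlow_eq_alpha r
    refine ⟨T t, ht ▸ hT.comp t, (hω t).trans ?_⟩
    rw [← hrt, ← Real.exp_mul, Real.exp_le_exp, mul_comm]
    gcongr
    exact le_max_left _ _
  · rintro ⟨a, ha, hα⟩ φ hφ
    choose T hT hTn using fun t => hα.exists_compositionOperator hι hstarstar
      (hφ.isUnivalentSelfMap t)
    have hS := IsCompositionOperator.isCompositionSemigroup hι hφ hT
    exact ⟨T, hS, hφ.isQuasicontractive ha hS.semigroup hTn⟩
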